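/- A partition $P$ of a finite metric space $(X,\rho)$ consists of clusters, and $P(x)$ denotes the cluster containing $x$. For $\Delta>0$ and $\beta\in\mathbb{R}$, a probability distribution $\mathcal{D}$ over partitions of $X$ is a $(\beta,\Delta)$-Lipschitz decomposition of $X$ if every cluster of every partition in the support of $\mathcal{D}$ has diameter at most $\Delta$, and $\Pr_{P\sim\mathcal{D}}[P(x)\neq P(y)]\le \beta\,\rho(x,y)/\Delta$ for all $x,y\in X$. Let $\beta^*(X)$ be the infimum of all $\beta\ge 1$ such that $X$ admits a $(\beta,\Delta)$-Lipschitz decomposition for every $\Delta>0$, and for a metric space $Y$ let $\beta^*_n(Y)$ be the supremum of $\beta^*(X)$ over all $n$-point subsets $X\subseteq Y$. Let $\ell_p$ be the space of real sequences with finite $\ell_p$ norm, and put $1/\infty=0$. **Theorem.** There is a universal constant $C>0$ such that for every $p\in[2,\infty]$: 1. $\beta^*_n(\ell_p)\le C(\log n)^{1-1/p}$ for every $n\ge 2$; 2. for every $n\ge 1$, every $n$-point set $X\subset\ell_p$ (with the metric of $\ell_p$) and every $\Delta>0$, there exists a $(C(\log n)^{1-1/p},\Delta)$-Lipschitz decomposition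 of $X$. -/

import Mathlib

open scoped ENNReal

noncomputable section

/-- A distribution `D` over partitions of the finite metric space `X` is `(β, Δ)`-Lipschitz.
A partition of `X` is given by its equivalence relation `P : Setoid X` ("being in the same
cluster"); its clusters are the members of `P.classes`, and `P(x) ≠ P(y)` means `¬ P x y`.
The space of partitions of a finite set is finite, so a distribution over it is a `PMF`, and
`D.toOuterMeasure A` is the probability of the event `A`. -/
structure IsLipschitzDecomposition {X : Type*} [MetricSpace X] [Finite X]
    (D : PMF (Setoid X)) (β Δ : ℝ) : Prop where
  /-- every cluster of every partition in the support has diameter at most `Δ` -/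
  diam_le : ∀ P ∈ D.support, ∀ C ∈ P.classes, Metric.diam C ≤ Δ
  /-- `Pr[P(x) ≠ P(y)] ≤ β * ρ(x, y) / Δ` -/
  separation_le : ∀ x y : X,
    (D.toOuterMeasure {P : Setoid X | ¬ P x y}).toReal ≤ β * (dist x y / Δ)

/-- `X` admits a `(β, Δ)`-Lipschitz decomposition. -/
def AdmitsLipschitzDecomposition (X : Type*) [MetricSpace X] [Finite X] (β Δ : ℝ) : Prop :=
  ∃ D : PMF (Setoid X), IsLipschitzDecomposition D β Δ

/-- The decomposition parameter `β*(X)`: the infimum, in `[0, ∞]`, of all real `β ≥ 1` such that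
`X` admits a `(β, Δ)`-Lipschitz decomposition for every `Δ > 0`. -/
def betaStar (X : Type*) [MetricSpace X] [Finite X] : ℝ≥0∞ :=
  ⨅ (β : ℝ) (_ : 1 ≤ β) (_ : ∀ Δ : ℝ, 0 < Δ → AdmitsLipschitzDecomposition X β Δ),
    ENNReal.ofReal β

/-- The decomposition parameter of a family of finite subspaces of a metric space `Y`. -/
def betaStarFamily {Y : Type*} [MetricSpace Y] (F : Set (Finset Y)) : ℝ≥0∞ :=
  ⨆ X ∈ F, betaStar X

/-- `β*ₙ(Y)`: the decomposition parameter of the family of all `n`-point subsets of `Y`. -/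
def betaStarN (n : ℕ) (Y : Type*) [MetricSpace Y] : ℝ≥0∞ :=
  betaStarFamily {X : Finset Y | X.card = n}

end

/-!
A random set of small diameter that separates a pair rarely compared with how often it touches the
pair yields a Lipschitz decomposition, by carving independent copies one after the other
(`admits_of_pmf_set`). Such sets are level sets `{x | τ < U x ω}` of random weights `U x ≥ 0` at a
uniform level `τ`: the pair `x, y` is separated with measure `∫ |U x - U y|`, the point `x` is
touched with measure `∫ U x`, and level sets of large diameter may be discarded as long as
`∫ min (U x) (U z)` is at most `∫ U x / (2 n)` for far `x, z` (`admits_of_weights`).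

Two kinds of weights are multiplied. The exponential decay `exp (-l * dist c x)` away from a center
`c` ranging over the space, with `l = log (2 n) / r`, is `l`-Lipschitz on a logarithmic scale and
is negligible outside the ball of radius `r` around `c`. The Gaussian weights
`exp (⟪v, g⟫ - ‖v‖² / 2)` of vectors `v` are densities of translates of the Gaussian measure. Their
Hellinger affinities are `exp (-‖v - w‖² / 8)`, so their overlap is at most `1 / (4 n ^ 2)` once
`‖v - w‖² ≥ 16 log (2 n)`, while their total variation distance is at most `‖v - w‖`. The vectors
only have to be controlled on the balls of radius `r` (`admits_of_local_embeddings`).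

In `ℓ_p` take for `v` a multiple of the Mazur map into `ℓ_2`, applied to `x - c`. On the ball of
radius `r` it has Lipschitz constant at most `p * r ^ (p / 2 - 1)`, and it maps points at distance
`Δ / 2` to points at distance at least `2 (Δ / 4) ^ (p / 2)`. With `r = Δ t` the decay contributes
`log n / t` to `β`, and the Mazur map contributes `√(log n) * p * (4 t) ^ (p / 2) / t`. For
`t = (log n) ^ (1 / p) / 16` both are of order `(log n) ^ (1 - 1 / p)`, uniformly in `p`. For
`p = ∞` the decay alone suffices, with `r = Δ / 4`.
-/

open MeasureTheory ProbabilityTheory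

/-! ### Iterated carving of random sets -/

theorem PMF.toOuterMeasure_le_one {α : Type*} (p : PMF α) (A : Set α) :
    p.toOuterMeasure A ≤ 1 := by
  rw [← (PMF.toOuterMeasure_apply_eq_one_iff p (s := Set.univ)).2 (Set.subset_univ _)]
  exact MeasureTheory.measure_mono (Set.subset_univ _)

theorem PMF.toOuterMeasure_ne_top {α : Type*} (p : PMF α) (A : Set α) :
    p.toOuterMeasure A ≠ ∞ :=
  ((PMF.toOuterMeasure_le_one p A).trans_lt ENNReal.one_lt_top).ne

/-- The partition whose clusters are `S` and the traces on the complement of `S` of the clusters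
of `P`. -/
def carve {X : Type*} (S : Set X) (P : Setoid X) : Setoid X where
  r x y := (x ∈ S ↔ y ∈ S) ∧ (x ∈ S ∨ P x y)
  iseqv :=
    { refl := fun x => ⟨Iff.rfl, Or.inr (P.refl' x)⟩
      symm := fun {x y} h => ⟨h.1.symm, h.2.imp h.1.1 P.symm'⟩
      trans := fun {x y z} h h' => ⟨h.1.trans h'.1, by
        rcases h.2 with hx | hx
        · exact Or.inl hx
        · exact h'.2.imp h.1.2 (P.trans' hx)⟩ }

theorem carve_apply {X : Type*} (S : Set X) (P : Setoid X) (x y : X) :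
    carve S P x y ↔ (x ∈ S ↔ y ∈ S) ∧ (x ∈ S ∨ P x y) := Iff.rfl

/-- The random partition obtained by carving `k` independent samples of `μ` one after the other,
the points left over becoming singletons. -/
noncomputable def carveIter {X : Type*} (μ : PMF (Set X)) : ℕ → PMF (Setoid X)
  | 0 => PMF.pure ⊥
  | k + 1 => μ.bind fun S => (carveIter μ k).map (carve S)

theorem dist_le_of_mem_support_carveIter {X : Type*} [MetricSpace X] {μ : PMF (Set X)} {Δ : ℝ}
    (hΔ : 0 ≤ Δ) (hμ : ∀ S ∈ μ.support, ∀ x ∈ S, ∀ y ∈ S, dist x y ≤ Δ) (k : ℕ) :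
    ∀ P ∈ (carveIter μ k).support, ∀ x y, P x y → dist x y ≤ Δ := by
  induction k with
  | zero =>
    intro P hP x y hxy
    simp only [carveIter, PMF.support_pure, Set.mem_singleton_iff] at hP
    subst hP
    have : x = y := hxy
    simpa [this] using hΔ
  | succ k ih =>
    intro P hP x y hxy
    simp only [carveIter, PMF.mem_support_bind_iff, PMF.mem_support_map_iff] at hP
    obtain ⟨S, hS, Q, hQ, rfl⟩ := hP
    obtain ⟨hiff, hx | hx⟩ := (carve_apply S Q x y).1 hxy
    · exact hμ S hS x hx y (hiff.1 hx)
    · exact ih Q hQ x y hx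

theorem carveIter_succ_separation_le {X : Type*} (μ : PMF (Set X)) (k : ℕ) (x y : X) :
    (carveIter μ (k + 1)).toOuterMeasure {P | ¬ P x y} ≤
      μ.toOuterMeasure {S | ¬ (x ∈ S ↔ y ∈ S)} +
        μ.toOuterMeasure {S | x ∉ S ∧ y ∉ S} * (carveIter μ k).toOuterMeasure {P | ¬ P x y} := by
  rw [carveIter, PMF.toOuterMeasure_bind_apply, PMF.toOuterMeasure_apply μ,
    PMF.toOuterMeasure_apply μ, ← ENNReal.tsum_mul_right, ← ENNReal.tsum_add]
  refine ENNReal.tsum_le_tsum fun S => ?_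
  rw [PMF.toOuterMeasure_map_apply]
  have hle := PMF.toOuterMeasure_le_one (carveIter μ k)
  by_cases hx : x ∈ S <;> by_cases hy : y ∈ S
  · have : (carve S ⁻¹' {P : Setoid X | ¬ P x y}) = ∅ := by
      ext P; simp [carve_apply, hx, hy]
    simp [this]
  · simp only [Set.indicator, Set.mem_ofPred_eq, hx, hy]
    simpa using mul_le_mul_right (hle _) (μ S)
  · simp only [Set.indicator, Set.mem_ofPred_eq, hx, hy]
    simpa using mul_le_mul_right (hle _) (μ S)
  · have : (carve S ⁻¹' {P : Setoid X | ¬ P x y}) = {P : Setoid X | ¬ P x y} := by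
      ext P; simp [carve_apply, hx, hy]
    simp [this, Set.indicator, hx, hy]

/-- A pair is separated by the first sample that touches it, or never touched. If a sample touches
the pair with probability at least `q` and separates it with probability at most `ε q`, then the
first event has conditional probability at most `ε`, and the second one decays geometrically. -/
theorem carveIter_separation_le {X : Type*} (μ : PMF (Set X)) {x y : X} {ε q : ℝ} (hε : 0 ≤ ε)
    (hsep : (μ.toOuterMeasure {S | ¬ (x ∈ S ↔ y ∈ S)}).toReal ≤ ε * q)
    (hmiss : (μ.toOuterMeasure {S | x ∉ S ∧ y ∉ S}).toReal ≤ 1 - q) (k : ℕ) :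
    ((carveIter μ k).toOuterMeasure {P | ¬ P x y}).toReal ≤ ε + (1 - q) ^ k := by
  induction k with
  | zero =>
    have h := PMF.toOuterMeasure_le_one (carveIter μ 0) {P | ¬ P x y}
    have := ENNReal.toReal_mono ENNReal.one_ne_top h
    rw [ENNReal.toReal_one] at this
    rw [pow_zero]
    linarith
  | succ k ih =>
    have h := ENNReal.toReal_mono (ENNReal.add_ne_top.2 ⟨PMF.toOuterMeasure_ne_top _ _,
      ENNReal.mul_ne_top (PMF.toOuterMeasure_ne_top _ _) (PMF.toOuterMeasure_ne_top _ _)⟩)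
      (carveIter_succ_separation_le μ k x y)
    rw [ENNReal.toReal_add (PMF.toOuterMeasure_ne_top _ _)
      (ENNReal.mul_ne_top (PMF.toOuterMeasure_ne_top _ _) (PMF.toOuterMeasure_ne_top _ _)),
      ENNReal.toReal_mul] at h
    have hq : 0 ≤ 1 - q := ENNReal.toReal_nonneg.trans hmiss
    have h2 := mul_le_mul hmiss ih ENNReal.toReal_nonneg hq
    rw [pow_succ]
    nlinarith

/-- A distribution over sets of small diameter that touches every point, and that separates a pair
with probability at most `L * dist x y` times that of touching it, yields a Lipschitz decomposition.
The factor `2` pays for stopping the carving after finitely many steps. -/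
theorem admits_of_pmf_set {X : Type*} [MetricSpace X] [Finite X] (μ : PMF (Set X)) {Δ L : ℝ}
    (hΔ : 0 < Δ) (hL : 0 < L) (hμ : ∀ S ∈ μ.support, ∀ x ∈ S, ∀ y ∈ S, dist x y ≤ Δ)
    (q : X → X → ℝ) (hq : ∀ x y, 0 < q x y)
    (hsep : ∀ x y, (μ.toOuterMeasure {S | ¬ (x ∈ S ↔ y ∈ S)}).toReal ≤ L * dist x y * q x y)
    (hmiss : ∀ x y, (μ.toOuterMeasure {S | x ∉ S ∧ y ∉ S}).toReal ≤ 1 - q x y) :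
    AdmitsLipschitzDecomposition X (2 * L * Δ) Δ := by
  obtain ⟨k, hk⟩ : ∃ k : ℕ, ∀ x y : X, x ≠ y → (1 - q x y) ^ k ≤ L * dist x y := by
    have : ∀ᶠ k : ℕ in Filter.atTop, ∀ x y : X, x ≠ y → (1 - q x y) ^ k ≤ L * dist x y := by
      refine Filter.eventually_all.2 fun x => Filter.eventually_all.2 fun y => ?_
      by_cases hxy : x = y
      · simp [hxy]
      · have h0 : 0 ≤ 1 - q x y := ENNReal.toReal_nonneg.trans (hmiss x y)
        have ht := tendsto_pow_atTop_nhds_zero_of_lt_one h0 (by linarith [hq x y])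
        filter_upwards [ht.eventually_le_const (mul_pos hL (dist_pos.2 hxy))] with k hk _ using hk
    exact this.exists
  refine ⟨carveIter μ k, ⟨fun P hP C hC => ?_, fun x y => ?_⟩⟩
  · obtain ⟨z, rfl⟩ := hC
    refine Metric.diam_le_of_forall_dist_le hΔ.le fun x hx y hy => ?_
    exact dist_le_of_mem_support_carveIter hΔ.le hμ k P hP x y (P.trans' hx (P.symm' hy))
  · have heq : 2 * L * Δ * (dist x y / Δ) = 2 * (L * dist x y) := by field_simp
    rw [heq]
    by_cases hxy : x = y
    · simp [← hxy]
    · have h := carveIter_separation_le μ (mul_nonneg hL.le dist_nonneg) (hsep x y) (hmiss x y) k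
      linarith [hk x y hxy]

/-! ### Carving by level sets of random weights -/

/-- The points whose weight exceeds the level `p.2`, or no point at all if these points are spread
over a distance greater than `Δ`. -/
def levelCluster {X Ω : Type*} [Dist X] (U : X → Ω → ℝ) (Δ : ℝ) (p : Ω × ℝ) : Set X :=
  {x | p.2 < U x p.1 ∧ ∀ y z, p.2 < U y p.1 → p.2 < U z p.1 → dist y z ≤ Δ}

theorem measurableSet_lt_weight {X Ω : Type*} [MeasurableSpace Ω] {U : X → Ω → ℝ}
    (hU : ∀ x, Measurable (U x)) (x : X) : MeasurableSet {p : Ω × ℝ | p.2 < U x p.1} :=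
  measurableSet_lt measurable_snd ((hU x).comp measurable_fst)

theorem measurable_levelCluster {X Ω : Type*} [Dist X] [Finite X] [MeasurableSpace Ω]
    {U : X → Ω → ℝ} (hU : ∀ x, Measurable (U x)) (Δ : ℝ) : Measurable (levelCluster U Δ) := by
  refine measurable_set_iff.2 fun x => measurable_to_prop ?_
  have hset : (fun p => x ∈ levelCluster U Δ p) ⁻¹' {True} = {p : Ω × ℝ | p.2 < U x p.1} ∩
      ⋂ y, ⋂ z, ({p : Ω × ℝ | p.2 < U y p.1} ∩ {p : Ω × ℝ | p.2 < U z p.1} ∩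
        {_p : Ω × ℝ | ¬ dist y z ≤ Δ})ᶜ := by
    ext p
    simp only [levelCluster, Set.mem_preimage, Set.mem_ofPred_eq, Set.mem_singleton_iff, eq_iff_iff,
      iff_true, Set.mem_inter_iff, Set.mem_iInter, Set.mem_compl_iff]
    refine and_congr_right fun _ => forall_congr' fun y => forall_congr' fun z => ?_
    tauto
  rw [hset]
  exact (measurableSet_lt_weight hU x).inter (.iInter fun y => .iInter fun z =>
    (((measurableSet_lt_weight hU y).inter (measurableSet_lt_weight hU z)).inter (.const _)).compl)

/-- The measure on pairs (sample, level) restricted to the levels between `0` and the largest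
weight. -/
noncomputable def levelMeasure {X Ω : Type*} [MeasurableSpace Ω] (κ : Measure Ω) (U : X → Ω → ℝ) :
    Measure (Ω × ℝ) :=
  (κ.prod volume).restrict {p | 0 < p.2 ∧ ∃ x, p.2 < U x p.1}

section LevelMeasure

variable {X Ω : Type*} [MeasurableSpace Ω] {κ : Measure Ω} [SigmaFinite κ] {U : X → Ω → ℝ}

theorem levelMeasure_forall_lt (hU : ∀ x, Measurable (U x)) (hint : ∀ x, Integrable (U x) κ)
    (hnn : ∀ x ω, 0 ≤ U x ω) (x y : X) :
    levelMeasure κ U ({p | p.2 < U x p.1} ∩ {p | p.2 < U y p.1}) =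
      ENNReal.ofReal (∫ ω, min (U x ω) (U y ω) ∂κ) := by
  rw [levelMeasure, Measure.restrict_apply
    ((measurableSet_lt_weight hU x).inter (measurableSet_lt_weight hU y))]
  have hset : {p : Ω × ℝ | p.2 < U x p.1} ∩ {p | p.2 < U y p.1} ∩
      {p | 0 < p.2 ∧ ∃ x, p.2 < U x p.1} =
      regionBetween 0 (fun ω => min (U x ω) (U y ω)) Set.univ := by
    ext p
    simp only [regionBetween, Set.mem_inter_iff, Set.mem_ofPred_eq, Set.mem_univ, true_and,
      Set.mem_Ioo, lt_min_iff, Pi.zero_apply]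
    exact ⟨fun h => ⟨h.2.1, h.1⟩, fun h => ⟨h.2, h.1, x, h.2.1⟩⟩
  have hmin : Integrable (fun ω => min (U x ω) (U y ω)) κ := (hint x).inf (hint y)
  rw [hset, volume_regionBetween_eq_integral (integrable_zero _ _ _).integrableOn
    hmin.integrableOn MeasurableSet.univ (fun ω _ => le_min (hnn x ω) (hnn y ω))]
  simp

theorem levelMeasure_lt (hU : ∀ x, Measurable (U x)) (hint : ∀ x, Integrable (U x) κ)
    (hnn : ∀ x ω, 0 ≤ U x ω) (x : X) :
    levelMeasure κ U {p | p.2 < U x p.1} = ENNReal.ofReal (∫ ω, U x ω ∂κ) := by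
  simpa using levelMeasure_forall_lt hU hint hnn x x

theorem isFiniteMeasure_levelMeasure [Finite X] (hU : ∀ x, Measurable (U x))
    (hint : ∀ x, Integrable (U x) κ) (hnn : ∀ x ω, 0 ≤ U x ω) :
    IsFiniteMeasure (levelMeasure κ U) := by
  have := Fintype.ofFinite X
  refine ⟨?_⟩
  have hc : levelMeasure κ U (⋃ x, {p | p.2 < U x p.1})ᶜ = 0 := by
    rw [levelMeasure, Measure.restrict_apply
      (MeasurableSet.iUnion fun x => measurableSet_lt_weight hU x).compl]
    refine measure_mono_null (fun p hp => ?_) measure_empty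
    simp only [Set.mem_inter_iff, Set.mem_compl_iff, Set.mem_iUnion, Set.mem_ofPred_eq] at hp
    exact hp.1 hp.2.2
  calc levelMeasure κ U Set.univ
      ≤ levelMeasure κ U (⋃ x, {p | p.2 < U x p.1})
        + levelMeasure κ U (⋃ x, {p | p.2 < U x p.1})ᶜ := by
        rw [← Set.union_compl_self (⋃ x, {p : Ω × ℝ | p.2 < U x p.1})]
        exact measure_union_le _ _
    _ = levelMeasure κ U (⋃ x, {p | p.2 < U x p.1}) := by rw [hc, add_zero]
    _ ≤ ∑ x, levelMeasure κ U {p | p.2 < U x p.1} := measure_iUnion_fintype_le _ _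
    _ < ∞ := ENNReal.sum_lt_top.2 fun x _ => by
        rw [levelMeasure_lt hU hint hnn]; exact ENNReal.ofReal_lt_top

end LevelMeasure

theorem integral_abs_sub_eq {Ω : Type*} [MeasurableSpace Ω] {κ : Measure Ω} {f g : Ω → ℝ}
    (hf : Integrable f κ) (hg : Integrable g κ) :
    ∫ ω, |f ω - g ω| ∂κ = ∫ ω, f ω ∂κ + ∫ ω, g ω ∂κ - 2 * ∫ ω, min (f ω) (g ω) ∂κ := by
  have hm : Integrable (fun ω => min (f ω) (g ω)) κ := hf.inf hg
  rw [← integral_const_mul, ← integral_add hf hg, ← integral_sub (by fun_prop) (by fun_prop)]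
  refine integral_congr_ae (.of_forall fun ω => ?_)
  rcases le_total (f ω) (g ω) with h | h
  · simp only [min_eq_left h, abs_of_nonpos (sub_nonpos.2 h)]; ring
  · simp only [min_eq_right h, abs_of_nonneg (sub_nonneg.2 h)]; ring

/-- Random nonnegative weights on `X` yield a Lipschitz decomposition as soon as far points are
rarely heavy simultaneously and the weights are Lipschitz on average. Carve the level sets of the
weights at a uniform level, discarding those of large diameter. -/
theorem admits_of_weights {X Ω : Type*} [MetricSpace X] [Finite X] [Nonempty X]
    [MeasurableSpace Ω] (κ : Measure Ω) [SigmaFinite κ] {U : X → Ω → ℝ}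
    (hU : ∀ x, Measurable (U x)) (hint : ∀ x, Integrable (U x) κ) (hnn : ∀ x ω, 0 ≤ U x ω)
    {Δ L : ℝ} (hΔ : 0 < Δ) (hL : 0 < L) (hpos : ∀ x, 0 < ∫ ω, U x ω ∂κ)
    (hfar : ∀ x z, Δ / 2 < dist x z →
      Nat.card X * ∫ ω, min (U x ω) (U z ω) ∂κ ≤ (∫ ω, U x ω ∂κ) / 2)
    (hlip : ∀ x y, ∫ ω, |U x ω - U y ω| ∂κ ≤
      L * dist x y * (∫ ω, U x ω ∂κ + ∫ ω, U y ω ∂κ)) :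
    AdmitsLipschitzDecomposition X (8 * L * Δ) Δ := by
  have := Fintype.ofFinite X
  classical
  set ρ := levelMeasure κ U with hρ
  have hfin : IsFiniteMeasure ρ := isFiniteMeasure_levelMeasure hU hint hnn
  have hA : ∀ x, ρ.real {p | p.2 < U x p.1} = ∫ ω, U x ω ∂κ := fun x => by
    rw [Measure.real, hρ, levelMeasure_lt hU hint hnn, ENNReal.toReal_ofReal (hpos x).le]
  have hAA : ∀ x y, ρ.real ({p | p.2 < U x p.1} ∩ {p | p.2 < U y p.1}) =
      ∫ ω, min (U x ω) (U y ω) ∂κ := fun x y => by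
    rw [Measure.real, hρ, levelMeasure_forall_lt hU hint hnn, ENNReal.toReal_ofReal
      (integral_nonneg fun ω => le_min (hnn x ω) (hnn y ω))]
  have hρ0 : NeZero ρ := by
    refine ⟨fun h => ?_⟩
    obtain ⟨x⟩ := ‹Nonempty X›
    have := hA x
    rw [h] at this
    simp only [measureReal_zero, Pi.zero_apply] at this
    exact (hpos x).ne this
  have hT := measurable_levelCluster hU Δ
  have hZ : 0 < ρ.real Set.univ := measureReal_univ_pos
  have : IsProbabilityMeasure (ρ[|Set.univ]) :=
    cond_isProbabilityMeasure (NeZero.ne _)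
  have : IsProbabilityMeasure ((ρ[|Set.univ]).map (levelCluster U Δ)) :=
    Measure.isProbabilityMeasure_map hT.aemeasurable
  set μ := ((ρ[|Set.univ]).map (levelCluster U Δ)).toPMF with hμ
  have hμA : ∀ A : Set (Set X),
      (μ.toOuterMeasure A).toReal = ρ.real (levelCluster U Δ ⁻¹' A) / ρ.real Set.univ := by
    intro A
    rw [← PMF.toMeasure_apply_eq_toOuterMeasure_apply _ (Set.toFinite A).measurableSet, hμ,
      Measure.toPMF_toMeasure, Measure.map_apply hT (Set.toFinite A).measurableSet,
      cond_apply MeasurableSet.univ, Set.univ_inter, ENNReal.toReal_mul, ENNReal.toReal_inv,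
      Measure.real, Measure.real, div_eq_inv_mul]
  -- At most half of the level sets through `x` can be discarded: these contain a point at distance
  -- more than `Δ / 2` from `x`.
  have hkeep : ∀ x, (∫ ω, U x ω ∂κ) / 2 ≤ ρ.real {p | x ∈ levelCluster U Δ p} := by
    intro x
    set F : Finset X := Finset.univ.filter fun z => Δ / 2 < dist x z
    have hsub : {p : Ω × ℝ | p.2 < U x p.1} ⊆ {p | x ∈ levelCluster U Δ p} ∪
        ⋃ z ∈ F, ({p | p.2 < U x p.1} ∩ {p | p.2 < U z p.1}) := by
      intro p hp
      by_cases hx : x ∈ levelCluster U Δ p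
      · exact Or.inl hx
      · right
        simp only [levelCluster, Set.mem_ofPred_eq, not_and, not_forall] at hx
        obtain ⟨y, z, hy, hz, hyz⟩ := hx hp
        simp only [Set.mem_iUnion]
        by_cases hxy : Δ / 2 < dist x y
        · exact ⟨y, by simpa [F] using hxy, hp, hy⟩
        · refine ⟨z, ?_, hp, hz⟩
          have := dist_triangle_left y z x
          simp only [F, Finset.mem_filter, Finset.mem_univ, true_and]
          linarith
    have h1 := (measureReal_mono hsub (measure_ne_top ρ _)).trans (measureReal_union_le _ _)
    have h2 : ρ.real (⋃ z ∈ F, ({p : Ω × ℝ | p.2 < U x p.1} ∩ {p | p.2 < U z p.1})) ≤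
        (∫ ω, U x ω ∂κ) / 2 := by
      refine (measureReal_biUnion_finset_le _ _).trans ?_
      simp only [hAA]
      have hcard : (0 : ℝ) < Nat.card X := Nat.cast_pos.2 Nat.card_pos
      calc ∑ z ∈ F, ∫ ω, min (U x ω) (U z ω) ∂κ
          ≤ ∑ z ∈ F, (∫ ω, U x ω ∂κ) / 2 / Nat.card X := by
            refine Finset.sum_le_sum fun z hz => ?_
            rw [le_div_iff₀ hcard, mul_comm]
            exact hfar x z (by simpa [F] using hz)
        _ = F.card * ((∫ ω, U x ω ∂κ) / 2 / Nat.card X) := by rw [Finset.sum_const, nsmul_eq_mul]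
        _ ≤ Nat.card X * ((∫ ω, U x ω ∂κ) / 2 / Nat.card X) := by
            refine mul_le_mul_of_nonneg_right ?_ (by have := hpos x; positivity)
            rw [Nat.card_eq_fintype_card]
            exact_mod_cast F.card_le_univ
        _ = (∫ ω, U x ω ∂κ) / 2 := by field_simp
    rw [hA] at h1
    linarith
  have hsepAux : ∀ x y, ρ.real {p | ¬ (x ∈ levelCluster U Δ p ↔ y ∈ levelCluster U Δ p)} ≤
      ∫ ω, |U x ω - U y ω| ∂κ := by
    intro x y
    have hd : ∀ x y, ρ.real ({p | p.2 < U x p.1} \ {p | p.2 < U y p.1}) =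
        ∫ ω, U x ω ∂κ - ∫ ω, min (U x ω) (U y ω) ∂κ := fun x y => by
      have := measureReal_inter_add_sdiff (μ := ρ) (s := {p : Ω × ℝ | p.2 < U x p.1})
        (measurableSet_lt_weight hU y)
      rw [hAA, hA] at this
      linarith
    have hsub : {p | ¬ (x ∈ levelCluster U Δ p ↔ y ∈ levelCluster U Δ p)} ⊆
        ({p | p.2 < U x p.1} \ {p | p.2 < U y p.1}) ∪
          ({p | p.2 < U y p.1} \ {p | p.2 < U x p.1}) := by
      intro p hp
      simp only [levelCluster, Set.mem_ofPred_eq] at hp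
      simp only [Set.mem_union, Set.mem_sdiff, Set.mem_ofPred_eq]
      tauto
    refine (measureReal_mono hsub (measure_ne_top ρ _)).trans
      ((measureReal_union_le _ _).trans (le_of_eq ?_))
    rw [hd, hd, integral_abs_sub_eq (hint x) (hint y)]
    simp only [min_comm (U y _) (U x _)]
    ring
  have h8 : 8 * L * Δ = 2 * (4 * L) * Δ := by ring
  rw [h8]
  set q : X → X → ℝ := fun x y =>
    ρ.real {p | x ∈ levelCluster U Δ p ∨ y ∈ levelCluster U Δ p} / ρ.real Set.univ with hq
  have hqx : ∀ x y, (∫ ω, U x ω ∂κ) / 2 ≤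
      ρ.real {p | x ∈ levelCluster U Δ p ∨ y ∈ levelCluster U Δ p} := fun x y =>
    (hkeep x).trans (measureReal_mono (fun p hp => Or.inl hp) (measure_ne_top ρ _))
  have hqy : ∀ x y, (∫ ω, U y ω ∂κ) / 2 ≤
      ρ.real {p | x ∈ levelCluster U Δ p ∨ y ∈ levelCluster U Δ p} := fun x y =>
    (hkeep y).trans (measureReal_mono (fun p hp => Or.inr hp) (measure_ne_top ρ _))
  refine admits_of_pmf_set μ hΔ (by positivity) ?_ q ?_ ?_ ?_
  · intro S hS x hx y hy
    have hne : μ.toOuterMeasure {S} ≠ 0 := by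
      rw [PMF.toOuterMeasure_apply_singleton]
      exact (PMF.mem_support_iff _ _).1 hS
    have hne' : levelCluster U Δ ⁻¹' {S} ≠ ∅ := by
      intro h
      have h' := hμA {S}
      rw [h, measureReal_empty, zero_div, ENNReal.toReal_eq_zero_iff] at h'
      exact h'.elim hne (PMF.toOuterMeasure_ne_top _ _)
    obtain ⟨p, hp⟩ := Set.nonempty_iff_ne_empty.2 hne'
    rw [Set.mem_preimage, Set.mem_singleton_iff] at hp
    rw [← hp] at hx hy
    exact hx.2 x y hx.1 hy.1
  · intro x y
    exact div_pos (lt_of_lt_of_le (half_pos (hpos x)) (hqx x y)) hZ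
  · intro x y
    rw [hμA, hq, ← mul_div_assoc]
    refine div_le_div_of_nonneg_right ?_ hZ.le
    refine (hsepAux x y).trans ((hlip x y).trans ?_)
    have h1 : 0 ≤ L * dist x y := mul_nonneg hL.le dist_nonneg
    nlinarith [hqx x y, hqy x y]
  · intro x y
    rw [hμA, hq, le_sub_iff_add_le, ← add_div, div_le_one hZ]
    rw [← measureReal_union]
    · exact measureReal_mono (Set.subset_univ _) (measure_ne_top ρ _)
    · refine Set.disjoint_left.2 fun p hp hp' => ?_
      exact hp'.elim hp.1 hp.2
    · exact hT (Set.toFinite {S : Set X | x ∈ S ∨ y ∈ S}).measurableSet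

/-! ### Localizing weights to balls -/

theorem integrable_count_prod {ι Ω : Type*} [Finite ι] [MeasurableSpace ι]
    [MeasurableSingletonClass ι] [MeasurableSpace Ω] {γ : Measure Ω} [SFinite γ] {f : ι → Ω → ℝ}
    (hf : ∀ i, Measurable (f i)) (hint : ∀ i, Integrable (f i) γ) :
    Integrable (fun p : ι × Ω => f p.1 p.2) (Measure.count.prod γ) := by
  have hm : Measurable (fun p : ι × Ω => f p.1 p.2) := measurable_from_prod_countable_right hf
  rw [integrable_prod_iff hm.aestronglyMeasurable]
  exact ⟨.of_forall hint, .of_finite⟩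

theorem integral_count_prod {ι Ω : Type*} [Fintype ι] [MeasurableSpace ι]
    [MeasurableSingletonClass ι] [MeasurableSpace Ω] {γ : Measure Ω} [SFinite γ] {f : ι → Ω → ℝ}
    (hf : ∀ i, Measurable (f i)) (hint : ∀ i, Integrable (f i) γ) :
    ∫ p : ι × Ω, f p.1 p.2 ∂(Measure.count.prod γ) = ∑ i, ∫ ω, f i ω ∂γ := by
  rw [integral_prod _ (integrable_count_prod hf hint), integral_count]

/-- The exponential decay `exp (-l * t)`, lowered by `δ` and cut off at `0`. -/
noncomputable def cutoffExp (l δ t : ℝ) : ℝ := max 0 (Real.exp (-(l * t)) - δ)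

theorem cutoffExp_nonneg (l δ t : ℝ) : 0 ≤ cutoffExp l δ t := le_max_left _ _

theorem cutoffExp_le_one {l δ t : ℝ} (hl : 0 ≤ l) (hδ : 0 ≤ δ) (ht : 0 ≤ t) :
    cutoffExp l δ t ≤ 1 := by
  refine max_le zero_le_one ?_
  have : Real.exp (-(l * t)) ≤ 1 := Real.exp_le_one_iff.2 (by have := mul_nonneg hl ht; linarith)
  linarith

theorem abs_cutoffExp_sub_le {l δ : ℝ} (hl : 0 ≤ l) (s t : ℝ) :
    |cutoffExp l δ s - cutoffExp l δ t| ≤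
      l * |s - t| * (cutoffExp l δ s + cutoffExp l δ t + δ) := by
  have key : ∀ s t : ℝ, s ≤ t → |cutoffExp l δ s - cutoffExp l δ t| ≤
      l * |s - t| * (cutoffExp l δ s + δ) := by
    intro s t hst
    have hmono : Real.exp (-(l * t)) ≤ Real.exp (-(l * s)) :=
      Real.exp_le_exp.2 (by nlinarith)
    have h1 : |cutoffExp l δ s - cutoffExp l δ t| ≤
        Real.exp (-(l * s)) - Real.exp (-(l * t)) := by
      have h := abs_max_sub_max_le_abs (Real.exp (-(l * s)) - δ) (Real.exp (-(l * t)) - δ) 0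
      rw [max_comm _ (0 : ℝ), max_comm _ (0 : ℝ), sub_sub_sub_cancel_right,
        abs_of_nonneg (sub_nonneg.2 hmono)] at h
      exact h
    have h2 : Real.exp (-(l * s)) - Real.exp (-(l * t)) ≤
        l * (t - s) * Real.exp (-(l * s)) := by
      have he : Real.exp (-(l * t)) = Real.exp (-(l * s)) * Real.exp (-(l * (t - s))) := by
        rw [← Real.exp_add]; ring_nf
      have := Real.add_one_le_exp (-(l * (t - s)))
      rw [he]
      nlinarith [Real.exp_pos (-(l * s))]
    have h3 : Real.exp (-(l * s)) ≤ cutoffExp l δ s + δ := by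
      have := le_max_right 0 (Real.exp (-(l * s)) - δ)
      rw [cutoffExp]; linarith
    rw [abs_sub_comm s t, abs_of_nonneg (sub_nonneg.2 hst)]
    exact h1.trans (h2.trans (mul_le_mul_of_nonneg_left h3
      (mul_nonneg hl (sub_nonneg.2 hst))))
  have hle : ∀ a b : ℝ, l * |a - b| * (cutoffExp l δ a + δ) ≤
      l * |a - b| * (cutoffExp l δ a + cutoffExp l δ b + δ) := fun a b =>
    mul_le_mul_of_nonneg_left (by linarith [cutoffExp_nonneg l δ b])
      (mul_nonneg hl (abs_nonneg _))
  rcases le_total s t with h | h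
  · exact (key s t h).trans (hle s t)
  · have := (key t s h).trans (hle t s)
    rwa [abs_sub_comm (cutoffExp l δ t), abs_sub_comm t s,
      add_comm (cutoffExp l δ t) (cutoffExp l δ s)] at this

/-- Random weights `V c` that are only controlled on the ball of radius `r` around `c` yield a
Lipschitz decomposition: multiply them by an exponential decay away from `c`, cut off at distance
`r`, and let `c` range over the space. The decay is slow enough for the cut-off to happen at the
relative height `1 / (2 n)`, where it is negligible even after summation over the `n` centers. -/
theorem admits_of_local_weights {X Ω : Type*} [MetricSpace X] [Finite X] [Nonempty X]
    [MeasurableSpace Ω] (γ : Measure Ω) [SigmaFinite γ] {V : X → X → Ω → ℝ}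
    (hV : ∀ c x, Measurable (V c x)) (hint : ∀ c x, Integrable (V c x) γ)
    (hnn : ∀ c x ω, 0 ≤ V c x ω) (hone : ∀ c x, ∫ ω, V c x ω ∂γ = 1)
    {Δ r K : ℝ} (hΔ : 0 < Δ) (hr : 0 < r) (hK : 0 ≤ K)
    (hlip : ∀ c x y, dist c x ≤ r → dist c y ≤ r → ∫ ω, |V c x ω - V c y ω| ∂γ ≤ K * dist x y)
    (hfar : ∀ c x z, dist c x ≤ r → dist c z ≤ r → Δ / 2 < dist x z →
      ∫ ω, min (V c x ω) (V c z ω) ∂γ ≤ 1 / (4 * (Nat.card X : ℝ) ^ 2)) :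
    AdmitsLipschitzDecomposition X
      (8 * (2 * (Real.log (2 * Nat.card X) / r) + K) * Δ) Δ := by
  have := Fintype.ofFinite X
  let _ : MeasurableSpace X := ⊤
  set n : ℝ := (Nat.card X : ℝ) with hn
  have hn1 : 1 ≤ n := by rw [hn]; exact_mod_cast Nat.card_pos
  have hncard : (Finset.univ : Finset X).card = n := by
    rw [hn, Nat.card_eq_fintype_card, Finset.card_univ]
  set l := Real.log (2 * n) / r with hl
  have hlpos : 0 < l := div_pos (Real.log_pos (by linarith)) hr
  set δ := 1 / (2 * n) with hδ
  have hδ0 : 0 < δ := by positivity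
  have hnδ : n * δ = 1 / 2 := by rw [hδ]; field_simp
  have hδr : Real.exp (-(l * r)) = δ := by
    rw [hl, div_mul_cancel₀ _ hr.ne', Real.exp_neg, Real.exp_log (by linarith), hδ, one_div]
  set W : X → X → ℝ := fun c x => cutoffExp l δ (dist c x) with hW
  have hW0 : ∀ c x, 0 ≤ W c x := fun c x => cutoffExp_nonneg _ _ _
  have hW1 : ∀ c x, W c x ≤ 1 := fun c x => cutoffExp_le_one hlpos.le hδ0.le dist_nonneg
  have hWr : ∀ c x, r < dist c x → W c x = 0 := fun c x h => by
    refine max_eq_left (sub_nonpos.2 ?_)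
    rw [← hδr]
    exact Real.exp_le_exp.2 (by nlinarith)
  have hWd : ∀ c x y, |W c x - W c y| ≤ l * dist x y * (W c x + W c y + δ) := fun c x y => by
    refine (abs_cutoffExp_sub_le hlpos.le _ _).trans ?_
    refine mul_le_mul_of_nonneg_right (mul_le_mul_of_nonneg_left ?_ hlpos.le)
      (by have := hW0 c x; have := hW0 c y; positivity)
    rw [dist_comm c x, dist_comm c y]
    exact abs_dist_sub_le x y c
  have hUint : ∀ x c, Integrable (fun ω => W c x * V c x ω) γ := fun x c => (hint c x).const_mul _
  have hUmeas : ∀ x c, Measurable (fun ω => W c x * V c x ω) := fun x c => (hV c x).const_mul _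
  set U : X → X × Ω → ℝ := fun x p => W p.1 x * V p.1 x p.2 with hU
  have hUI : ∀ x, ∫ p, U x p ∂(Measure.count.prod γ) = ∑ c, W c x := fun x => by
    rw [integral_count_prod (f := fun c ω => W c x * V c x ω) (hUmeas x) (hUint x)]
    refine Finset.sum_congr rfl fun c _ => ?_
    rw [integral_const_mul, hone, mul_one]
  -- The center `c = x` alone contributes `1 - δ` to the total weight of `x`.
  have hhalf : ∀ x, 1 / 2 ≤ ∑ c, W c x := fun x => by
    refine le_trans ?_ (Finset.single_le_sum (fun c _ => hW0 c x) (Finset.mem_univ x))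
    have hδ2 : δ ≤ 1 / 2 := by nlinarith
    simp only [hW, cutoffExp, dist_self, mul_zero, neg_zero, Real.exp_zero]
    exact le_max_of_le_right (by linarith)
  refine admits_of_weights (Measure.count.prod γ) (U := U)
    (fun x => measurable_from_prod_countable_right (hUmeas x))
    (fun x => integrable_count_prod (f := fun c ω => W c x * V c x ω) (hUmeas x) (hUint x))
    (fun x p => mul_nonneg (hW0 _ _) (hnn _ _ _)) hΔ (by positivity)
    (fun x => by rw [hUI]; linarith [hhalf x]) ?_ ?_
  · intro x z hxz
    rw [hUI, integral_count_prod
      (f := fun c ω => min (W c x * V c x ω) (W c z * V c z ω))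
      (fun c => (hUmeas x c).min (hUmeas z c)) (fun c => (hUint x c).inf (hUint z c))]
    have hterm : ∀ c, ∫ ω, min (W c x * V c x ω) (W c z * V c z ω) ∂γ ≤ 1 / (4 * n ^ 2) := by
      intro c
      have hpos : 0 ≤ 1 / (4 * n ^ 2) := by positivity
      by_cases hx : dist c x ≤ r
      · by_cases hz : dist c z ≤ r
        · refine le_trans (integral_mono ((hUint x c).inf (hUint z c))
            ((hint c x).inf (hint c z)) fun ω => ?_) (hfar c x z hx hz hxz)
          exact min_le_min (mul_le_of_le_one_left (hnn _ _ _) (hW1 _ _))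
            (mul_le_of_le_one_left (hnn _ _ _) (hW1 _ _))
        · refine le_trans (le_of_eq ?_) hpos
          simp [hWr c z (not_le.1 hz), min_eq_right (mul_nonneg (hW0 c x) (hnn c x _))]
      · refine le_trans (le_of_eq ?_) hpos
        simp [hWr c x (not_le.1 hx), min_eq_left (mul_nonneg (hW0 c z) (hnn c z _))]
    have hsum := Finset.sum_le_sum fun c (_ : c ∈ Finset.univ) => hterm c
    rw [Finset.sum_const, nsmul_eq_mul, hncard] at hsum
    calc n * ∑ c, ∫ ω, min (W c x * V c x ω) (W c z * V c z ω) ∂γ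
        ≤ n * (n * (1 / (4 * n ^ 2))) := mul_le_mul_of_nonneg_left hsum (by linarith)
      _ = 1 / 4 := by field_simp
      _ ≤ _ := by linarith [hhalf x]
  · intro x y
    have hsub : ∀ c, Integrable (fun ω => |W c x * V c x ω - W c y * V c y ω|) γ :=
      fun c => ((hUint x c).sub (hUint y c)).abs
    rw [hUI, hUI, integral_count_prod (f := fun c ω => |W c x * V c x ω - W c y * V c y ω|)
      (fun c => ((hUmeas x c).sub (hUmeas y c)).abs) hsub]
    have hVd : ∀ c, Integrable (fun ω => |V c x ω - V c y ω|) γ :=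
      fun c => ((hint c x).sub (hint c y)).abs
    have hterm : ∀ c, ∫ ω, |W c x * V c x ω - W c y * V c y ω| ∂γ ≤
        |W c x - W c y| + W c y * (K * dist x y) := by
      intro c
      have hR : 0 ≤ W c y * (K * dist x y) :=
        mul_nonneg (hW0 c y) (mul_nonneg hK dist_nonneg)
      by_cases hx : dist c x ≤ r
      · by_cases hy : dist c y ≤ r
        · calc ∫ ω, |W c x * V c x ω - W c y * V c y ω| ∂γ
              ≤ ∫ ω, (|W c x - W c y| * V c x ω + W c y * |V c x ω - V c y ω|) ∂γ := by
                refine integral_mono (hsub c) (((hint c x).const_mul _).add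
                  ((hVd c).const_mul _)) fun ω => ?_
                have he : W c x * V c x ω - W c y * V c y ω =
                    (W c x - W c y) * V c x ω + W c y * (V c x ω - V c y ω) := by ring
                have h := abs_add_le ((W c x - W c y) * V c x ω)
                  (W c y * (V c x ω - V c y ω))
                rw [abs_mul, abs_mul, abs_of_nonneg (hnn c x ω), abs_of_nonneg (hW0 c y),
                  ← he] at h
                exact h
            _ = |W c x - W c y| + W c y * ∫ ω, |V c x ω - V c y ω| ∂γ := by
                rw [integral_add ((hint c x).const_mul _)
                  ((hVd c).const_mul _), integral_const_mul,
                  integral_const_mul, hone, mul_one]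
            _ ≤ _ := by
                have := mul_le_mul_of_nonneg_left (hlip c x y hx hy) (hW0 c y)
                linarith
        · have h0 := hWr c y (not_le.1 hy)
          have he : ∫ ω, |W c x * V c x ω - W c y * V c y ω| ∂γ = W c x := by
            simp only [h0, zero_mul, sub_zero, abs_of_nonneg (mul_nonneg (hW0 c x) (hnn c x _))]
            rw [integral_const_mul, hone, mul_one]
          rw [he, h0, sub_zero, abs_of_nonneg (hW0 c x)]
          simp
      · have h0 := hWr c x (not_le.1 hx)
        have he : ∫ ω, |W c x * V c x ω - W c y * V c y ω| ∂γ = W c y := by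
          simp only [h0, zero_mul, zero_sub, abs_neg,
            abs_of_nonneg (mul_nonneg (hW0 c y) (hnn c y _))]
          rw [integral_const_mul, hone, mul_one]
        rw [he, h0, zero_sub, abs_neg, abs_of_nonneg (hW0 c y)]
        linarith
    calc ∑ c, ∫ ω, |W c x * V c x ω - W c y * V c y ω| ∂γ
        ≤ ∑ c, (l * dist x y * (W c x + W c y + δ) + W c y * (K * dist x y)) :=
          Finset.sum_le_sum fun c _ => (hterm c).trans (by linarith [hWd c x y])
      _ = l * dist x y * (∑ c, W c x + ∑ c, W c y + n * δ) + (∑ c, W c y) * (K * dist x y) := by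
          rw [Finset.sum_add_distrib, ← Finset.mul_sum, Finset.sum_add_distrib,
            Finset.sum_add_distrib, ← Finset.sum_mul, Finset.sum_const, nsmul_eq_mul, hncard]
      _ ≤ (2 * l + K) * dist x y * (∑ c, W c x + ∑ c, W c y) := by
          have h1 : 0 ≤ l * dist x y := mul_nonneg hlpos.le dist_nonneg
          have h2 : 0 ≤ K * dist x y := mul_nonneg hK dist_nonneg
          have hx := hhalf x
          have hy := hhalf y
          rw [hnδ]
          nlinarith

/-! ### Gaussian weights -/

section GaussianWeight

open scoped RealInnerProductSpace

variable {E : Type*} [NormedAddCommGroup E] [InnerProductSpace ℝ E]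

/-- The density at `g` of the standard Gaussian measure translated by `v`, relative to the
untranslated one. -/
noncomputable def gaussianWeight (v g : E) : ℝ := Real.exp (⟪v, g⟫ - ‖v‖ ^ 2 / 2)

theorem gaussianWeight_pos (v g : E) : 0 < gaussianWeight v g := Real.exp_pos _

theorem sqrt_gaussianWeight_mul (v w g : E) :
    √(gaussianWeight v g) * √(gaussianWeight w g) =
      Real.exp (⟪(2⁻¹ : ℝ) • (v + w), g⟫ - (‖v‖ ^ 2 + ‖w‖ ^ 2) / 4) := by
  rw [gaussianWeight, gaussianWeight, ← Real.exp_half, ← Real.exp_half, ← Real.exp_add,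
    real_inner_smul_left, inner_add_left]
  ring_nf

variable [FiniteDimensional ℝ E] [MeasurableSpace E] [BorelSpace E]

theorem measurable_gaussianWeight (v : E) : Measurable (gaussianWeight v) := by
  unfold gaussianWeight
  fun_prop

theorem mgf_inner_stdGaussian (v : E) (t : ℝ) :
    mgf (fun g => ⟪v, g⟫) (stdGaussian E) t = Real.exp (‖v‖ ^ 2 * t ^ 2 / 2) := by
  have hmap : (stdGaussian E).map (fun g => ⟪v, g⟫) =
      gaussianReal 0 (Real.toNNReal (‖v‖ ^ 2)) := by
    have h := IsGaussian.map_eq_gaussianReal (μ := stdGaussian E) (innerSL ℝ v)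
    rw [integral_strongDual_stdGaussian, variance_dual_stdGaussian, innerSL_apply_norm] at h
    exact h
  rw [mgf_gaussianReal hmap, Real.coe_toNNReal _ (sq_nonneg _), zero_mul, zero_add]

theorem integrable_exp_inner_sub (v : E) (a : ℝ) :
    Integrable (fun g => Real.exp (⟪v, g⟫ - a)) (stdGaussian E) := by
  have h : 0 < mgf (fun g => ⟪v, g⟫) (stdGaussian E) 1 := by
    rw [mgf_inner_stdGaussian]
    exact Real.exp_pos _
  rw [mgf_pos_iff] at h
  simp only [one_mul] at h
  simp only [Real.exp_sub]
  exact h.div_const _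

theorem integral_exp_inner_sub (v : E) (a : ℝ) :
    ∫ g, Real.exp (⟪v, g⟫ - a) ∂(stdGaussian E) = Real.exp (‖v‖ ^ 2 / 2 - a) := by
  have h := mgf_inner_stdGaussian v 1
  simp only [mgf, one_mul, one_pow, mul_one] at h
  simp only [Real.exp_sub, integral_div, h]

theorem integrable_gaussianWeight (v : E) : Integrable (gaussianWeight v) (stdGaussian E) :=
  integrable_exp_inner_sub v _

theorem integral_gaussianWeight (v : E) : ∫ g, gaussianWeight v g ∂(stdGaussian E) = 1 := by
  simp [gaussianWeight, integral_exp_inner_sub]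

theorem integrable_sqrt_gaussianWeight_mul (v w : E) :
    Integrable (fun g => √(gaussianWeight v g) * √(gaussianWeight w g)) (stdGaussian E) := by
  simp only [sqrt_gaussianWeight_mul]
  exact integrable_exp_inner_sub _ _

/-- The Hellinger affinity of two translates of the standard Gaussian measure. -/
theorem integral_sqrt_gaussianWeight_mul (v w : E) :
    ∫ g, √(gaussianWeight v g) * √(gaussianWeight w g) ∂(stdGaussian E) =
      Real.exp (-‖v - w‖ ^ 2 / 8) := by
  simp only [sqrt_gaussianWeight_mul, integral_exp_inner_sub]
  congr 1
  have h := parallelogram_law_with_norm ℝ v w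
  rw [norm_smul, mul_pow]
  norm_num
  linarith

theorem integral_min_gaussianWeight_le (v w : E) :
    ∫ g, min (gaussianWeight v g) (gaussianWeight w g) ∂(stdGaussian E) ≤
      Real.exp (-‖v - w‖ ^ 2 / 8) := by
  rw [← integral_sqrt_gaussianWeight_mul]
  refine integral_mono ((integrable_gaussianWeight v).inf (integrable_gaussianWeight w))
    (integrable_sqrt_gaussianWeight_mul v w) fun g => ?_
  have hv := gaussianWeight_pos v g
  have hw := gaussianWeight_pos w g
  simp only
  rw [← Real.sqrt_mul hv.le]
  refine Real.le_sqrt_of_sq_le ?_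
  rw [sq]
  exact mul_le_mul (min_le_left _ _) (min_le_right _ _) (le_min hv.le hw.le) hv.le

/-- The total variation estimate follows from the Hellinger affinity: write the difference of the
densities as `(√f - √h) (√f + √h)` and apply the inequality of arithmetic and geometric means. -/
theorem integral_abs_gaussianWeight_sub_le (v w : E) :
    ∫ g, |gaussianWeight v g - gaussianWeight w g| ∂(stdGaussian E) ≤ ‖v - w‖ := by
  rcases eq_or_ne v w with rfl | hne
  · simp
  set s := ‖v - w‖ with hs
  have hs0 : 0 < s := norm_pos_iff.2 (sub_ne_zero.2 hne)
  have hpt : ∀ g, |gaussianWeight v g - gaussianWeight w g| ≤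
      (2 / s + s / 8) * (gaussianWeight v g + gaussianWeight w g) +
        (s / 4 - 4 / s) * (√(gaussianWeight v g) * √(gaussianWeight w g)) := by
    intro g
    have ha := Real.sq_sqrt (gaussianWeight_pos v g).le
    have hb := Real.sq_sqrt (gaussianWeight_pos w g).le
    set a := √(gaussianWeight v g)
    set b := √(gaussianWeight w g)
    rw [← ha, ← hb]
    have hab : |a ^ 2 - b ^ 2| = |a - b| * (a + b) := by
      rw [show a ^ 2 - b ^ 2 = (a - b) * (a + b) by ring, abs_mul,
        abs_of_nonneg (add_nonneg (Real.sqrt_nonneg _) (Real.sqrt_nonneg _))]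
    -- The weights in the mean are such that both summands integrate to at most `s / 2`.
    have hsq := sq_nonneg (2 * |a - b| - s / 2 * (a + b))
    have h2 : (2 / s + s / 8) * (a ^ 2 + b ^ 2) + (s / 4 - 4 / s) * (a * b) =
        (4 * |a - b| ^ 2 + (s / 2 * (a + b)) ^ 2) / (2 * s) := by
      rw [sq_abs]
      field_simp
      ring
    rw [hab, h2, le_div_iff₀ (by positivity)]
    nlinarith
  have hI : Integrable (fun g => gaussianWeight v g + gaussianWeight w g) (stdGaussian E) :=
    (integrable_gaussianWeight v).add (integrable_gaussianWeight w)
  have hA := integrable_sqrt_gaussianWeight_mul v w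
  have h1 := integral_mono
    ((integrable_gaussianWeight v).sub (integrable_gaussianWeight w)).abs
    ((hI.const_mul (2 / s + s / 8)).add (hA.const_mul (s / 4 - 4 / s))) hpt
  have h2 : ∫ g, (gaussianWeight v g + gaussianWeight w g) ∂(stdGaussian E) = 2 := by
    rw [integral_add (integrable_gaussianWeight v) (integrable_gaussianWeight w),
      integral_gaussianWeight, integral_gaussianWeight]
    norm_num
  refine h1.trans ?_
  simp only [Pi.add_apply]
  rw [integral_add (hI.const_mul (2 / s + s / 8)) (hA.const_mul (s / 4 - 4 / s)),
    integral_const_mul, integral_const_mul, integral_sqrt_gaussianWeight_mul, h2, ← hs]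
  have hexp1 : Real.exp (-s ^ 2 / 8) ≤ 1 :=
    Real.exp_le_one_iff.2 (by nlinarith)
  have hexp2 := Real.add_one_le_exp (-s ^ 2 / 8)
  set e := Real.exp (-s ^ 2 / 8)
  have h3 : (2 / s + s / 8) * 2 + (s / 4 - 4 / s) * e = (4 * (1 - e)) / s + s / 4 * (1 + e) := by
    field_simp
    ring
  have h4 : (4 * (1 - e)) / s ≤ s / 2 := by
    rw [div_le_iff₀ hs0]
    nlinarith
  have h5 : s / 4 * (1 + e) ≤ s / 2 := by nlinarith
  rw [h3]
  linarith

end GaussianWeight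

/-- Maps `f c` into an inner product space that are Lipschitz on the ball of radius `r` around `c` and
there separate far points yield a Lipschitz decomposition, by carving with Gaussian weights. The
measure lives on the span of the finitely many vectors `f c x`. -/
theorem admits_of_local_embeddings {X H : Type*} [MetricSpace X] [Finite X] [Nonempty X]
    [NormedAddCommGroup H] [InnerProductSpace ℝ H] (f : X → X → H)
    {Δ r K : ℝ} (hΔ : 0 < Δ) (hr : 0 < r) (hK : 0 ≤ K)
    (hlip : ∀ c x y, dist c x ≤ r → dist c y ≤ r → ‖f c x - f c y‖ ≤ K * dist x y)
    (hfar : ∀ c x z, dist c x ≤ r → dist c z ≤ r → Δ / 2 < dist x z →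
      16 * Real.log (2 * Nat.card X) ≤ ‖f c x - f c z‖ ^ 2) :
    AdmitsLipschitzDecomposition X
      (8 * (2 * (Real.log (2 * Nat.card X) / r) + K) * Δ) Δ := by
  let S : Submodule ℝ H := Submodule.span ℝ (Set.range (Function.uncurry f))
  have : FiniteDimensional ℝ S := FiniteDimensional.span_of_finite ℝ (Set.finite_range _)
  let _ : MeasurableSpace S := borel S
  have : BorelSpace S := ⟨rfl⟩
  let u : X → X → S := fun c x => ⟨f c x, Submodule.subset_span ⟨(c, x), rfl⟩⟩
  have hu : ∀ c x y, ‖u c x - u c y‖ = ‖f c x - f c y‖ := fun c x y => rfl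
  refine admits_of_local_weights (stdGaussian S) (V := fun c x => gaussianWeight (u c x))
    (fun c x => measurable_gaussianWeight _) (fun c x => integrable_gaussianWeight _)
    (fun c x g => (gaussianWeight_pos _ _).le) (fun c x => integral_gaussianWeight _) hΔ hr hK ?_ ?_
  · intro c x y hx hy
    exact (integral_abs_gaussianWeight_sub_le _ _).trans (hu c x y ▸ hlip c x y hx hy)
  · intro c x z hx hz hxz
    refine (integral_min_gaussianWeight_le _ _).trans ?_
    have hn : (0 : ℝ) < 2 * Nat.card X := by
      have : 0 < Nat.card X := Nat.card_pos
      positivity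
    have h := hfar c x z hx hz hxz
    have he : 1 / (4 * (Nat.card X : ℝ) ^ 2) = Real.exp (-(2 * Real.log (2 * Nat.card X))) := by
      rw [two_mul (Real.log _), neg_add, Real.exp_add, Real.exp_neg, Real.exp_log hn]
      field_simp
      norm_num
    rw [he, hu]
    exact Real.exp_le_exp.2 (by linarith)

/-! ### The Mazur map -/

/-- The odd extension of `a ↦ a ^ s` from `[0, ∞)` to `ℝ`, for `s ≥ 1`. -/
noncomputable def signedRpow (s a : ℝ) : ℝ := a * |a| ^ (s - 1)

theorem signedRpow_neg (s a : ℝ) : signedRpow s (-a) = -signedRpow s a := by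
  simp [signedRpow]

theorem signedRpow_of_nonneg {s a : ℝ} (hs : 1 ≤ s) (ha : 0 ≤ a) : signedRpow s a = a ^ s := by
  rcases ha.eq_or_lt with rfl | ha
  · rw [signedRpow, zero_mul, Real.zero_rpow (by linarith)]
  · rw [signedRpow, abs_of_pos ha, mul_comm, ← Real.rpow_add_one ha.ne', sub_add_cancel]

theorem abs_signedRpow {s : ℝ} (hs : 1 ≤ s) (a : ℝ) : |signedRpow s a| = |a| ^ s := by
  rw [← signedRpow_of_nonneg hs (abs_nonneg a), signedRpow, signedRpow, abs_mul, abs_abs,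
    abs_of_nonneg (Real.rpow_nonneg (abs_nonneg a) _)]

theorem rpow_sub_rpow_le {s a b : ℝ} (hs : 1 ≤ s) (hb : 0 ≤ b) (hab : b ≤ a) :
    a ^ s - b ^ s ≤ s * a ^ (s - 1) * (a - b) := by
  rcases (hb.trans hab).eq_or_lt with rfl | ha
  · have : b = 0 := le_antisymm hab hb
    simp [this]
  · have h := one_add_mul_self_le_rpow_one_add (s := b / a - 1) (p := s)
      (by linarith [div_nonneg hb ha.le]) hs
    rw [add_sub_cancel, Real.div_rpow hb ha.le, le_div_iff₀ (Real.rpow_pos_of_pos ha s)] at h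
    have he : a ^ s = a ^ (s - 1) * a := by
      rw [← Real.rpow_add_one ha.ne', sub_add_cancel]
    have h2 : (1 + s * (b / a - 1)) * a ^ s = a ^ s + s * a ^ (s - 1) * (b - a) := by
      rw [he]
      field_simp
    rw [h2] at h
    linarith

theorem abs_signedRpow_sub_le {s : ℝ} (hs : 1 ≤ s) (a b : ℝ) :
    |signedRpow s a - signedRpow s b| ≤ s * max |a| |b| ^ (s - 1) * |a - b| := by
  have key : ∀ a b : ℝ, 0 ≤ b → b ≤ a →
      |signedRpow s a - signedRpow s b| ≤ s * max |a| |b| ^ (s - 1) * |a - b| := by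
    intro a b hb hab
    have ha := hb.trans hab
    rw [signedRpow_of_nonneg hs ha, signedRpow_of_nonneg hs hb, abs_of_nonneg ha,
      abs_of_nonneg hb, max_eq_left hab, abs_of_nonneg (sub_nonneg.2 hab),
      abs_of_nonneg (sub_nonneg.2 (Real.rpow_le_rpow hb hab (by linarith)))]
    exact rpow_sub_rpow_le hs hb hab
  have key2 : ∀ a b : ℝ, 0 ≤ a → 0 ≤ b →
      |signedRpow s a - signedRpow s b| ≤ s * max |a| |b| ^ (s - 1) * |a - b| := by
    intro a b ha hb
    rcases le_total b a with h | h
    · exact key a b hb h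
    · have := key b a ha h
      rwa [abs_sub_comm, max_comm, abs_sub_comm b a] at this
  have key3 : ∀ a b : ℝ, 0 ≤ a → b ≤ 0 →
      |signedRpow s a - signedRpow s b| ≤ s * max |a| |b| ^ (s - 1) * |a - b| := by
    intro a b ha hb
    have hm : 0 ≤ max |a| |b| ^ (s - 1) := Real.rpow_nonneg (le_max_of_le_left (abs_nonneg _)) _
    have h1 : |a| ^ (s - 1) ≤ max |a| |b| ^ (s - 1) :=
      Real.rpow_le_rpow (abs_nonneg _) (le_max_left _ _) (by linarith)
    have h2 : |b| ^ (s - 1) ≤ max |a| |b| ^ (s - 1) :=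
      Real.rpow_le_rpow (abs_nonneg _) (le_max_right _ _) (by linarith)
    have h3 : 0 ≤ a * |a| ^ (s - 1) - b * |b| ^ (s - 1) := by
      have := mul_nonneg ha (Real.rpow_nonneg (abs_nonneg a) (s - 1))
      have := mul_nonpos_of_nonpos_of_nonneg hb (Real.rpow_nonneg (abs_nonneg b) (s - 1))
      linarith
    rw [signedRpow, signedRpow, abs_of_nonneg h3, abs_of_nonneg (by linarith : 0 ≤ a - b)]
    calc a * |a| ^ (s - 1) - b * |b| ^ (s - 1) ≤ 1 * max |a| |b| ^ (s - 1) * (a - b) := by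
          nlinarith [mul_le_mul_of_nonneg_left h1 ha,
            mul_le_mul_of_nonneg_left h2 (neg_nonneg.2 hb)]
      _ ≤ s * max |a| |b| ^ (s - 1) * (a - b) := by
          refine mul_le_mul_of_nonneg_right (mul_le_mul_of_nonneg_right hs hm) (by linarith)
  rcases le_total 0 a with ha | ha <;> rcases le_total 0 b with hb | hb
  · exact key2 a b ha hb
  · exact key3 a b ha hb
  · have := key3 b a hb ha
    rwa [abs_sub_comm, max_comm, abs_sub_comm b a] at this
  · have := key2 (-a) (-b) (neg_nonneg.2 ha) (neg_nonneg.2 hb)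
    rwa [signedRpow_neg, signedRpow_neg, neg_sub_neg, abs_sub_comm, abs_neg, abs_neg, neg_sub_neg,
      abs_sub_comm b a] at this

theorem abs_sub_rpow_le_signedRpow {s : ℝ} (hs : 1 ≤ s) (a b : ℝ) :
    |a - b| ^ s ≤ 2 ^ (s - 1) * |signedRpow s a - signedRpow s b| := by
  have h2 : (1 : ℝ) ≤ 2 ^ (s - 1) := Real.one_le_rpow (by norm_num) (by linarith)
  have key : ∀ a b : ℝ, 0 ≤ b → b ≤ a →
      |a - b| ^ s ≤ 2 ^ (s - 1) * |signedRpow s a - signedRpow s b| := by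
    intro a b hb hab
    have ha := hb.trans hab
    have h := Real.add_rpow_le_rpow_add (sub_nonneg.2 hab) hb hs
    rw [sub_add_cancel] at h
    rw [signedRpow_of_nonneg hs ha, signedRpow_of_nonneg hs hb, abs_of_nonneg (sub_nonneg.2 hab),
      abs_of_nonneg (sub_nonneg.2 (Real.rpow_le_rpow hb hab (by linarith)))]
    have h0 := Real.rpow_nonneg (sub_nonneg.2 hab) s
    nlinarith
  have key2 : ∀ a b : ℝ, 0 ≤ a → 0 ≤ b →
      |a - b| ^ s ≤ 2 ^ (s - 1) * |signedRpow s a - signedRpow s b| := by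
    intro a b ha hb
    rcases le_total b a with h | h
    · exact key a b hb h
    · have := key b a ha h
      rwa [abs_sub_comm b a, abs_sub_comm (signedRpow s b)] at this
  have key3 : ∀ a b : ℝ, 0 ≤ a → 0 ≤ b →
      |a - -b| ^ s ≤ 2 ^ (s - 1) * |signedRpow s a - signedRpow s (-b)| := by
    intro a b ha hb
    rw [signedRpow_neg, sub_neg_eq_add, sub_neg_eq_add, signedRpow_of_nonneg hs ha,
      signedRpow_of_nonneg hs hb, abs_of_nonneg (add_nonneg ha hb),
      abs_of_nonneg (add_nonneg (Real.rpow_nonneg ha _) (Real.rpow_nonneg hb _))]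
    have := NNReal.rpow_add_le_mul_rpow_add_rpow ⟨a, ha⟩ ⟨b, hb⟩ hs
    exact_mod_cast this
  rcases le_total 0 a with ha | ha <;> rcases le_total 0 b with hb | hb
  · exact key2 a b ha hb
  · simpa using key3 a (-b) ha (neg_nonneg.2 hb)
  · have := key3 b (-a) hb (neg_nonneg.2 ha)
    rwa [neg_neg, abs_sub_comm b a, abs_sub_comm (signedRpow s b)] at this
  · have := key2 (-a) (-b) (neg_nonneg.2 ha) (neg_nonneg.2 hb)
    rwa [signedRpow_neg, signedRpow_neg, neg_sub_neg, neg_sub_neg, abs_sub_comm b a,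
      abs_sub_comm (signedRpow s b)] at this

theorem rpow_sub_two_mul_sq_le {q w u : ℝ} (hq : 2 ≤ q) (hw : 0 ≤ w) (hu : 0 ≤ u) :
    w ^ (q - 2) * u ^ 2 ≤ w ^ q + u ^ q := by
  have hsplit : ∀ t : ℝ, 0 ≤ t → t ^ q = t ^ (q - 2) * t ^ 2 := fun t ht => by
    rw [← Real.rpow_natCast t 2, ← Real.rpow_add_of_nonneg ht (by linarith) (by norm_num)]
    norm_num
  rcases le_total w u with h | h
  · have h1 : w ^ (q - 2) ≤ u ^ (q - 2) := Real.rpow_le_rpow hw h (by linarith)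
    have := mul_le_mul_of_nonneg_right h1 (sq_nonneg u)
    rw [← hsplit u hu] at this
    linarith [Real.rpow_nonneg hw q]
  · have := mul_le_mul_of_nonneg_left (pow_le_pow_left₀ hu h 2) (Real.rpow_nonneg hw (q - 2))
    rw [← hsplit w hw] at this
    linarith [Real.rpow_nonneg hu q]

section Mazur

variable {ι : Type*} {p : ℝ≥0∞}

theorem two_le_toReal (hp : 2 ≤ p) (hp' : p ≠ ∞) : 2 ≤ p.toReal := by
  simpa using ENNReal.toReal_mono hp' hp

theorem sq_signedRpow_half {q : ℝ} (hq : 2 ≤ q) (a : ℝ) : signedRpow (q / 2) a ^ 2 = |a| ^ q := by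
  rw [← sq_abs, abs_signedRpow (by linarith), ← Real.rpow_mul_natCast (abs_nonneg a)]
  norm_num

theorem memℓp_signedRpow (hp : 2 ≤ p) (hp' : p ≠ ∞) (x : lp (fun _ : ι => ℝ) p) :
    Memℓp (fun i => signedRpow (p.toReal / 2) (x i)) 2 := by
  have h2 := two_le_toReal hp hp'
  refine memℓp_gen ?_
  have h := (lp.memℓp x).summable (by linarith)
  refine h.congr fun i => ?_
  simp only [ENNReal.toReal_ofNat, Real.rpow_ofNat, Real.norm_eq_abs, sq_abs]
  exact (sq_signedRpow_half h2 _).symm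

/-- The Mazur map from `ℓ_p` to `ℓ_2`, raising the absolute values of the coordinates to the power
`p / 2` and keeping their signs. -/
noncomputable def mazurMap (hp : 2 ≤ p) (hp' : p ≠ ∞) (x : lp (fun _ : ι => ℝ) p) :
    lp (fun _ : ι => ℝ) 2 :=
  ⟨fun i => signedRpow (p.toReal / 2) (x i), memℓp_signedRpow hp hp' x⟩

theorem hasSum_sq_mazurMap_sub (hp : 2 ≤ p) (hp' : p ≠ ∞) (x y : lp (fun _ : ι => ℝ) p) :
    HasSum (fun i => |signedRpow (p.toReal / 2) (x i) - signedRpow (p.toReal / 2) (y i)| ^ 2)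
      (‖mazurMap hp hp' x - mazurMap hp hp' y‖ ^ 2) := by
  have h := lp.hasSum_norm (p := 2) (by norm_num) (mazurMap hp hp' x - mazurMap hp hp' y)
  simp only [ENNReal.toReal_ofNat, Real.rpow_ofNat] at h
  exact h

theorem norm_sub_rpow_le_mazurMap (hp : 2 ≤ p) (hp' : p ≠ ∞) (x y : lp (fun _ : ι => ℝ) p) :
    ‖x - y‖ ^ p.toReal ≤
      2 ^ (p.toReal - 2) * ‖mazurMap hp hp' x - mazurMap hp hp' y‖ ^ 2 := by
  have h2 := two_le_toReal hp hp'
  have hs : 1 ≤ p.toReal / 2 := by linarith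
  refine hasSum_le (fun i => ?_) (lp.hasSum_norm (by linarith) (x - y))
    ((hasSum_sq_mazurMap_sub hp hp' x y).mul_left _)
  have h := pow_le_pow_left₀ (Real.rpow_nonneg (abs_nonneg _) _)
    (abs_sub_rpow_le_signedRpow hs (x i) (y i)) 2
  rw [mul_pow, ← Real.rpow_mul_natCast (abs_nonneg _), ← Real.rpow_mul_natCast (by norm_num)] at h
  convert h using 3
  · simp
  · push_cast; ring
  · push_cast; ring

/-- The local Lipschitz estimate for the Mazur map. Termwise it reduces to
`w ^ (p - 2) * u ^ 2 ≤ w ^ p + u ^ p`, applied to coordinates scaled by `r` and to differences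
scaled by `‖x - y‖`. -/
theorem norm_mazurMap_sub_le [Fact (1 ≤ p)] (hp : 2 ≤ p) (hp' : p ≠ ∞) (x y : lp (fun _ : ι => ℝ) p) {r : ℝ}
    (hr : 0 < r) (hx : ‖x‖ ≤ r) (hy : ‖y‖ ≤ r) :
    ‖mazurMap hp hp' x - mazurMap hp hp' y‖ ≤
      p.toReal * r ^ (p.toReal / 2 - 1) * ‖x - y‖ := by
  have h2 := two_le_toReal hp hp'
  set q := p.toReal with hq
  have hq0 : 0 < q := by linarith
  have hs : 1 ≤ q / 2 := by linarith
  rcases eq_or_ne x y with rfl | hne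
  · simp
  set D := ‖x - y‖ with hD
  have hD0 : 0 < D := norm_pos_iff.2 (sub_ne_zero.2 hne)
  have hsx := (lp.hasSum_norm hq0 x)
  have hsy := (lp.hasSum_norm hq0 y)
  have hsd := (lp.hasSum_norm hq0 (x - y))
  have hsum := ((((hsx.add hsy).div_const (r ^ q)).add (hsd.div_const (D ^ q))).mul_left
    ((q / 2) ^ 2 * (r ^ (q - 2) * D ^ 2)))
  have hle := hasSum_le (fun i => ?_) (hasSum_sq_mazurMap_sub hp hp' x y) hsum
  · have hxr : ‖x‖ ^ q ≤ r ^ q := Real.rpow_le_rpow (norm_nonneg _) hx hq0.le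
    have hyr : ‖y‖ ^ q ≤ r ^ q := Real.rpow_le_rpow (norm_nonneg _) hy hq0.le
    have h3 : (‖x‖ ^ q + ‖y‖ ^ q) / r ^ q + D ^ q / D ^ q ≤ 3 := by
      rw [div_self (Real.rpow_pos_of_pos hD0 q).ne']
      have : (‖x‖ ^ q + ‖y‖ ^ q) / r ^ q ≤ 2 := by
        rw [div_le_iff₀ (Real.rpow_pos_of_pos hr q)]
        linarith
      linarith
    refine le_of_sq_le_sq ?_ (by positivity)
    refine hle.trans ?_
    have hrr : (r ^ (q / 2 - 1)) ^ 2 = r ^ (q - 2) := by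
      rw [← Real.rpow_mul_natCast hr.le]
      congr 1
      push_cast; ring
    rw [mul_pow, mul_pow, hrr]
    have hA : 0 ≤ r ^ (q - 2) * D ^ 2 := by positivity
    calc (q / 2) ^ 2 * (r ^ (q - 2) * D ^ 2) * ((‖x‖ ^ q + ‖y‖ ^ q) / r ^ q + D ^ q / D ^ q)
        ≤ (q / 2) ^ 2 * (r ^ (q - 2) * D ^ 2) * 3 :=
          mul_le_mul_of_nonneg_left h3 (by positivity)
      _ ≤ q ^ 2 * r ^ (q - 2) * D ^ 2 := by nlinarith [mul_nonneg (sq_nonneg q) hA]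
  · set m := max |x i| |y i| with hm
    have hm0 : 0 ≤ m := le_max_of_le_left (abs_nonneg _)
    have h := pow_le_pow_left₀ (abs_nonneg _) (abs_signedRpow_sub_le hs (x i) (y i)) 2
    rw [mul_pow, mul_pow, ← Real.rpow_mul_natCast hm0,
      show (q / 2 - 1) * ((2 : ℕ) : ℝ) = q - 2 by push_cast; ring] at h
    have hyoung := rpow_sub_two_mul_sq_le h2 (div_nonneg hm0 hr.le)
      (div_nonneg (abs_nonneg (x i - y i)) hD0.le)
    rw [Real.div_rpow hm0 hr.le, Real.div_rpow hm0 hr.le, Real.div_rpow (abs_nonneg _) hD0.le,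
      div_pow, div_mul_div_comm, div_le_iff₀ (by positivity)] at hyoung
    have hmq : m ^ q ≤ |x i| ^ q + |y i| ^ q := by
      have h1 := Real.rpow_nonneg (abs_nonneg (x i)) q
      have h2 := Real.rpow_nonneg (abs_nonneg (y i)) q
      rcases max_cases |x i| |y i| with h | h <;> rw [hm, h.1] <;> linarith
    have hmq' : m ^ q / r ^ q ≤ (|x i| ^ q + |y i| ^ q) / r ^ q :=
      div_le_div_of_nonneg_right hmq (Real.rpow_nonneg hr.le q)
    have hA : 0 ≤ r ^ (q - 2) * D ^ 2 := by positivity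
    calc |signedRpow (q / 2) (x i) - signedRpow (q / 2) (y i)| ^ 2
        ≤ (q / 2) ^ 2 * (m ^ (q - 2) * |x i - y i| ^ 2) := by linarith
      _ ≤ (q / 2) ^ 2 * ((m ^ q / r ^ q + |x i - y i| ^ q / D ^ q) * (r ^ (q - 2) * D ^ 2)) :=
          mul_le_mul_of_nonneg_left hyoung (sq_nonneg _)
      _ ≤ (q / 2) ^ 2 * (((|x i| ^ q + |y i| ^ q) / r ^ q + |x i - y i| ^ q / D ^ q) *
            (r ^ (q - 2) * D ^ 2)) :=
          mul_le_mul_of_nonneg_left (mul_le_mul_of_nonneg_right (by linarith) hA) (sq_nonneg _)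
      _ = (q / 2) ^ 2 * (r ^ (q - 2) * D ^ 2) *
            ((‖x i‖ ^ q + ‖y i‖ ^ q) / r ^ q + ‖(x - y) i‖ ^ q / D ^ q) := by
          simp only [Real.norm_eq_abs, lp.coeFn_sub, Pi.sub_apply]
          ring

end Mazur

/-! ### Decompositions of finite subsets of `ℓ_p` -/

theorem AdmitsLipschitzDecomposition.mono {X : Type*} [MetricSpace X] [Finite X] {β β' Δ : ℝ}
    (h : AdmitsLipschitzDecomposition X β Δ) (hΔ : 0 < Δ) (hβ : β ≤ β') :
    AdmitsLipschitzDecomposition X β' Δ := by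
  obtain ⟨D, hD⟩ := h
  exact ⟨D, hD.diam_le, fun x y => (hD.separation_le x y).trans
    (mul_le_mul_of_nonneg_right hβ (div_nonneg dist_nonneg hΔ.le))⟩

theorem admits_of_subsingleton (X : Type*) [MetricSpace X] [Finite X] [Subsingleton X] (β : ℝ)
    {Δ : ℝ} (hΔ : 0 < Δ) : AdmitsLipschitzDecomposition X β Δ := by
  refine ⟨PMF.pure ⊥, fun P _ C _ => ?_, fun x y => ?_⟩
  · rw [Metric.diam_subsingleton C.subsingleton_of_subsingleton]
    exact hΔ.le
  · simp [Subsingleton.elim x y]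

theorem log_two_mul_le {n : ℕ} (hn : 2 ≤ n) : Real.log (2 * n) ≤ 2 * Real.log n := by
  have h2 : (2 : ℝ) ≤ n := by exact_mod_cast hn
  rw [Real.log_mul (by norm_num) (by linarith)]
  linarith [Real.log_le_log (by norm_num) h2]

/-- Exponential decay alone decomposes any finite metric space: if balls have radius `Δ / 4`, no
further weights are needed. -/
theorem admits_log_card {X : Type*} [MetricSpace X] [Finite X] (hn : 2 ≤ Nat.card X) {Δ : ℝ}
    (hΔ : 0 < Δ) : AdmitsLipschitzDecomposition X (128 * Real.log (Nat.card X)) Δ := by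
  have : Nonempty X := (Nat.card_pos_iff.1 (by omega)).1
  have h := admits_of_local_embeddings (X := X) (H := ℝ) (fun _ _ => 0) hΔ
    (r := Δ / 4) (K := 0) (by positivity) le_rfl (by simp) fun c x z hx hz hxz => by
      have := dist_triangle_left x z c
      linarith
  refine h.mono hΔ ?_
  have hlog := log_two_mul_le hn
  have he : 8 * (2 * (Real.log (2 * Nat.card X) / (Δ / 4)) + 0) * Δ =
      64 * Real.log (2 * Nat.card X) := by
    field_simp
    ring
  rw [he]
  linarith

/-- For finite `p`, compose the decay towards `c` with Gaussian weights along the Mazur map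
centered at `c`. Balls of radius `Δ (log n) ^ (1 / p) / 16` balance the two contributions. -/
theorem admits_finset_lp {ι : Type*} {p : ℝ≥0∞} [Fact (1 ≤ p)] (hp : 2 ≤ p) (hp' : p ≠ ∞)
    (X : Finset (lp (fun _ : ι => ℝ) p)) (hn : 2 ≤ X.card) {Δ : ℝ} (hΔ : 0 < Δ) :
    AdmitsLipschitzDecomposition X (1024 * Real.log X.card ^ (1 - (p⁻¹).toReal)) Δ := by
  have hcard : Nat.card X = X.card := by simp
  have : Nonempty X := (Nat.card_pos_iff.1 (by omega)).1
  have h2 := two_le_toReal hp hp'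
  rw [ENNReal.toReal_inv]
  set q := p.toReal with hq
  have hq0 : 0 < q := by linarith
  set l := Real.log X.card with hl
  have hn1 : (1 : ℝ) < X.card := by exact_mod_cast (by omega : 1 < X.card)
  have hl0 : 0 < l := Real.log_pos hn1
  set m := Real.log (2 * X.card) with hm
  have hm0 : 0 < m := Real.log_pos (by linarith)
  have hml : m ≤ 2 * l := log_two_mul_le hn
  set T := l ^ q⁻¹ with hT
  have hT0 : 0 < T := Real.rpow_pos_of_pos hl0 _
  have hTq : T ^ (q / 2) = √l := by
    rw [hT, ← Real.rpow_mul hl0.le, Real.sqrt_eq_rpow]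
    congr 1
    field_simp
  set r := Δ * (T / 16) with hr
  have hr0 : 0 < r := by positivity
  set a := 2 * √m * ((Δ / 4) ^ (q / 2))⁻¹ with ha
  have hΔq : 0 < (Δ / 4) ^ (q / 2) := by positivity
  have ha0 : 0 < a := by positivity
  set f : X → X → lp (fun _ : ι => ℝ) 2 :=
    fun c x => a • mazurMap hp hp' (x.1 - c.1) with hf
  have hfn : ∀ c x y, ‖f c x - f c y‖ = a * ‖mazurMap hp hp' (x.1 - c.1) -
      mazurMap hp hp' (y.1 - c.1)‖ := fun c x y => by
    rw [hf, ← smul_sub, norm_smul, Real.norm_of_nonneg ha0.le]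
  have hdist : ∀ c x : X, ‖x.1 - c.1‖ = dist c x := fun c x => by
    rw [dist_comm, Subtype.dist_eq, dist_eq_norm]
  have hsub : ∀ c x y : X, ‖x.1 - c.1 - (y.1 - c.1)‖ = dist x y :=
    fun c x y => by rw [sub_sub_sub_cancel_right, Subtype.dist_eq, dist_eq_norm]
  have hmain := admits_of_local_embeddings f hΔ hr0 (K := a * (q * r ^ (q / 2 - 1)))
    (by positivity) ?_ ?_
  · refine hmain.mono hΔ ?_
    rw [hcard, ← hm]
    have hlT : l ^ (1 - q⁻¹) = l / T := by rw [Real.rpow_sub hl0, Real.rpow_one]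
    have h1 : m / r * Δ = 16 * (m / T) := by
      rw [hr]
      field_simp
    -- The factor `4 ^ (q / 2)` gained from the radius absorbs the Lipschitz constant `q`.
    have h4q : (4 : ℝ) ^ (q / 2) = 2 ^ q := by
      rw [show (4 : ℝ) = 2 ^ (2 : ℝ) by norm_num, ← Real.rpow_mul (by norm_num)]
      congr 1
      ring
    have hscale : r ^ (q / 2) / (Δ / 4) ^ (q / 2) = √l / 2 ^ q := by
      rw [← Real.div_rpow hr0.le (by positivity), ← hTq, ← h4q,
        ← Real.div_rpow hT0.le (by norm_num)]
      congr 1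
      rw [hr]
      field_simp
      norm_num
    have h2' : a * (q * r ^ (q / 2 - 1)) * Δ = 32 * (√m * √l) * (q / 2 ^ q) / T := by
      rw [Real.rpow_sub_one hr0.ne', ha]
      calc 2 * √m * ((Δ / 4) ^ (q / 2))⁻¹ * (q * (r ^ (q / 2) / r)) * Δ
          = 2 * √m * q * (r ^ (q / 2) / (Δ / 4) ^ (q / 2)) * (Δ / r) := by
            field_simp
        _ = 2 * √m * q * (√l / 2 ^ q) * (16 / T) := by
            rw [hscale, hr]
            congr 1
            field_simp
        _ = _ := by field_simp; ring
    have hq2 : q / 2 ^ q ≤ 1 := by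
      rw [div_le_one (by positivity)]
      have := one_add_mul_self_le_rpow_one_add (s := 1) (p := q) (by norm_num) (by linarith)
      norm_num at this
      linarith
    have hsq : √m * √l ≤ 2 * l := by
      have h3 := Real.sq_sqrt hm0.le
      have h4 := Real.sq_sqrt hl0.le
      nlinarith [sq_nonneg (√m - √l)]
    have h3 : 32 * (√m * √l) * (q / 2 ^ q) ≤ 64 * l := by
      have h5 : 0 ≤ 32 * (√m * √l) := by positivity
      have := mul_le_mul_of_nonneg_left hq2 h5
      linarith
    rw [hlT]
    calc 8 * (2 * (m / r) + a * (q * r ^ (q / 2 - 1))) * Δ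
        = 16 * (m / r * Δ) + 8 * (a * (q * r ^ (q / 2 - 1)) * Δ) := by ring
      _ = (256 * m + 8 * (32 * (√m * √l) * (q / 2 ^ q))) / T := by
          rw [h1, h2']
          ring
      _ ≤ 1024 * l / T  :=
          div_le_div_of_nonneg_right (by linarith) hT0.le
      _ = 1024 * (l / T) := by ring
  · intro c x y hx hy
    rw [hfn, mul_assoc a, ← hsub c x y]
    exact mul_le_mul_of_nonneg_left (norm_mazurMap_sub_le hp hp' _ _ hr0 ((hdist c x).trans_le hx)
      ((hdist c y).trans_le hy)) ha0.le
  · intro c x z hx hz hxz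
    have h := norm_sub_rpow_le_mazurMap hp hp' (x.1 - c.1) (z.1 - c.1)
    rw [hsub, ← hq] at h
    have hd : (Δ / 2) ^ q ≤ dist x z ^ q := Real.rpow_le_rpow (by positivity) hxz.le hq0.le
    rw [hcard, ← hm, hfn, mul_pow]
    set N := ‖mazurMap hp hp' (x.1 - c.1) -
      mazurMap hp hp' (z.1 - c.1)‖ ^ 2
    have ha2 : a ^ 2 * (Δ / 4) ^ q = 4 * m := by
      have : ((Δ / 4) ^ (q / 2)) ^ 2 = (Δ / 4) ^ q := by
        rw [← Real.rpow_mul_natCast (by positivity)]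
        norm_num
      rw [ha, mul_pow, mul_pow, Real.sq_sqrt hm0.le, inv_pow, this]
      have := Real.rpow_pos_of_pos (by positivity : 0 < Δ / 4) q
      field_simp
      norm_num
    have hN : 4 * (Δ / 4) ^ q ≤ N := by
      have h22 : (2 : ℝ) ^ (q - 2) = 2 ^ q / 4 := by
        rw [Real.rpow_sub (by norm_num)]
        norm_num
      have h24 : (Δ / 2) ^ q = 2 ^ q * (Δ / 4) ^ q := by
        rw [← Real.mul_rpow (by norm_num) (by positivity)]
        congr 1
        ring
      rw [h22] at h
      have h5 := hd.trans h
      rw [h24, div_mul_eq_mul_div, mul_div_assoc] at h5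
      have := le_of_mul_le_mul_left h5 (by positivity)
      linarith
    nlinarith [mul_le_mul_of_nonneg_left hN (sq_nonneg a)]

theorem betaStarN_le_of_admits {Y : Type*} [MetricSpace Y] {n : ℕ} {β : ℝ} (hβ : 1 ≤ β)
    (h : ∀ X : Finset Y, X.card = n → ∀ Δ : ℝ, 0 < Δ → AdmitsLipschitzDecomposition X β Δ) :
    betaStarN n Y ≤ ENNReal.ofReal β :=
  iSup₂_le fun X hX => (iInf₂_le β hβ).trans (iInf_le _ (h X hX))

theorem one_le_mul_log_rpow {n : ℕ} (hn : 2 ≤ n) {e : ℝ} (he0 : 0 ≤ e) (he1 : e ≤ 1) :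
    1 ≤ 1024 * Real.log n ^ e := by
  have h2 : (2 : ℝ) ≤ n := by exact_mod_cast hn
  have hlog : 1 / 2 ≤ Real.log n := by
    have := Real.log_le_log (by norm_num) h2
    linarith [Real.log_two_gt_d9]
  have h1 : (1 / 2 : ℝ) ^ e ≤ Real.log n ^ e := Real.rpow_le_rpow (by norm_num) hlog he0
  have h3 : (1 / 2 : ℝ) ^ (1 : ℝ) ≤ (1 / 2) ^ e :=
    Real.rpow_le_rpow_of_exponent_ge (by norm_num) (by norm_num) he1
  rw [Real.rpow_one] at h3
  linarith

theorem admits_finset_lp_of_two_le {p : ℝ≥0∞} [Fact (1 ≤ p)] (hp : 2 ≤ p)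
    (X : Finset (lp (fun _ : ℕ => ℝ) p)) (hn : 2 ≤ X.card) {Δ : ℝ} (hΔ : 0 < Δ) :
    AdmitsLipschitzDecomposition X (1024 * Real.log X.card ^ (1 - (p⁻¹).toReal)) Δ := by
  by_cases hp' : p = ∞
  · have hcard : Nat.card X = X.card := by simp
    have h := admits_log_card (X := X) (by omega) hΔ
    rw [hcard] at h
    refine h.mono hΔ ?_
    have he : (p⁻¹).toReal = 0 := by simp [hp']
    rw [he, sub_zero, Real.rpow_one]
    linarith [Real.log_natCast_nonneg X.card]
  · exact admits_finset_lp hp hp' X hn hΔ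

theorem theorem1p2 :
    ∃ C : ℝ, 0 < C ∧ ∀ (p : ℝ≥0∞) [Fact (1 ≤ p)], 2 ≤ p →
      (∀ n : ℕ, 2 ≤ n →
        betaStarN n (lp (fun _ : ℕ => ℝ) p) ≤
          ENNReal.ofReal (C * Real.log n ^ (1 - (p⁻¹).toReal))) ∧
      (∀ n : ℕ, 1 ≤ n → ∀ X : Finset (lp (fun _ : ℕ => ℝ) p), X.card = n →
        ∀ Δ : ℝ, 0 < Δ →
          AdmitsLipschitzDecomposition X (C * Real.log n ^ (1 - (p⁻¹).toReal)) Δ) := by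
  refine ⟨1024, by norm_num, fun p _ hp => ⟨fun n hn => ?_, fun n hn X hX Δ hΔ => ?_⟩⟩
  · have hp1 : (p⁻¹).toReal ≤ 1 := by
      have h1 : p⁻¹ ≤ 1 := ENNReal.inv_le_one.2 Fact.out
      simpa using ENNReal.toReal_mono ENNReal.one_ne_top h1
    refine betaStarN_le_of_admits (one_le_mul_log_rpow hn (by linarith)
      (by linarith [ENNReal.toReal_nonneg (a := p⁻¹)])) fun X hX Δ hΔ => ?_
    subst hX
    exact admits_finset_lp_of_two_le hp X hn hΔ
  · subst hX
    rcases hn.eq_or_lt with h1 | h2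
    · have : Subsingleton X :=
        (Finset.card_le_one_iff_subsingleton_coe).1 h1.symm.le
      exact admits_of_subsingleton X _ hΔ
    · exact admits_finset_lp_of_two_le hp X h2 hΔ
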